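/- Let $k \ge 2$ be an integer. Write $[n_1,\ldots,n_k]$ for the least common multiple of positive integers $n_1,\ldots,n_k$, and for real $x$ put $$V_k(x) = \sum_{n_1,\ldots,n_k\le x} \frac{n_1\cdots n_k}{[n_1,\ldots,n_k]},$$ the sum being over all $k$-tuples of positive integers that are at most $x$. For an integer $x \ge 2$ let $X_1^{(x)},\ldots,X_k^{(x)}$ be independent random variables, each uniformly distributed on $\{1,\ldots,x\}$. Then there are constants $c, C > 0$ depending only on $k$ such that, for every integer $x \ge 2$, $$c \log^{2^k-k-1} x \le \mathbb{E}\left(\frac{X_1^{(x)}\cdots X_k^{(x)}}{[X_1^{(x)},\ldots,X_k^{(x)}]}\right) \le C \log^{2^k-k-1} x,$$ and, for every real $x \ge 2$, $$c \log^{2^k-k-1} x \le \frac{1}{x^k} \sum_{n_1,\ldots,n_k\le x} \frac{n_1\cdots n_k}{[n_1,\ldots,n_k]} \le C \log^{2^k-k-1} x;$$ equivalently, $c\, x^k \log^{2^k-k-1} x \le V_k(x) \le C\, x^k \log^{2^k-k-1} x$ for every real $x\ge 2$. (That is, $V_k(x) \asymp x^k \log^{2^k-k-1} x$.) -/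

import Mathlib

/-- The ratio `n₁ ⋯ n_k / [n₁, …, n_k]` of the product of a `k`-tuple to its least common
multiple, as a real number. -/
noncomputable def prodDivLcm {k : ℕ} (n : Fin k → ℕ) : ℝ :=
  (∏ i, (n i : ℝ)) / ((Finset.univ.lcm n : ℕ) : ℝ)

/-- `V_k(x) = ∑ n₁ ⋯ n_k / [n₁, …, n_k]`, summed over all `k`-tuples of positive integers
with `n₁, …, n_k ≤ x`, for a real number `x`. -/
noncomputable def lcmV (k : ℕ) (x : ℝ) : ℝ :=
  ∑ n ∈ Fintype.piFinset (fun _ : Fin k => Finset.Icc 1 ⌊x⌋₊), prodDivLcm n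

/-- `X₁, …, X_k` are independent random variables on the probability space `(Ω, P)`, each
uniformly distributed on `{1, …, x}`. -/
structure IsUniformSample {Ω : Type*} [MeasurableSpace Ω] (P : MeasureTheory.Measure Ω)
    (k x : ℕ) (X : Fin k → Ω → ℕ) : Prop where
  indep : ProbabilityTheory.iIndepFun X P
  law : ∀ i, ProbabilityTheory.HasLaw (X i) (ProbabilityTheory.uniformOn (Set.Icc 1 x)) P

/-! Every tuple can be written `n_i = ∏_{A ∋ i} m_A`, over nonempty `A ⊆ {1,…,k}`, with lcm exactly
`∏ m_A` (`exists_lcm_decomposition`). The ratio is then `∏ m_A ^ (|A| - 1)`. Fix the `m_A` with `|A|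
≥ 2`: the singleton variables have about `∏ N / shared_i` choices, and multiplying by the ratio
leaves `N ^ k ∏ 1 / m_A`. Summing gives one harmonic sum for each of the `2 ^ k - k - 1` large sets.

Upper bound: choose one decomposition per tuple and sum over all configurations
(`sum_prodDivLcm_le`).

Lower bound: for any configuration the lcm divides the product of the coordinates, so the ratio is
at least the weight (`weight_le_prodDivLcm_tuple`), but several configurations may give the same
tuple. Draw the large coordinates from a set `B` of integers free of primes `≤ P`, and discard
configurations in which a prime `> P` divides two coordinates. The rest are determined by their
tuples (`injOn_tuple`), and the discarded weight is `O(1 / P)` of the main term because `∑_{p > P}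
p⁻² ≤ 1 / P` (`sum_weight_not_isCoprimeAbove_le`). A large constant `P` suffices, and the harmonic
sum over `B` still has order `log N`. -/

/-! ### Factoring a tuple along sets of indices. -/

theorem exists_dvd_eq_prod_of_dvd_prod {α : Type*} [DecidableEq α] (s : Finset α) (f : α → ℕ) :
    ∀ g : ℕ, g ∣ ∏ a ∈ s, f a →
      ∃ f' : α → ℕ, (∀ a ∈ s, f' a ∣ f a) ∧ g = ∏ a ∈ s, f' a := by
  induction s using Finset.induction_on with
  | empty => intro g hg; exact ⟨fun _ => 1, by simp, by simpa using hg⟩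
  | insert b s hb ih =>
    intro g hg
    rw [Finset.prod_insert hb] at hg
    obtain ⟨u, v, hu, hv, rfl⟩ := exists_dvd_and_dvd_of_dvd_mul hg
    obtain ⟨f', hf', rfl⟩ := ih v hv
    refine ⟨Function.update f' b u, ?_, ?_⟩
    · intro a ha
      rcases Finset.mem_insert.1 ha with rfl | has
      · simpa using hu
      · rw [Function.update_of_ne (by rintro rfl; exact hb has)]
        exact hf' a has
    · rw [Finset.prod_insert hb, Function.update_self]
      congr 1
      refine Finset.prod_congr rfl fun a ha => ?_
      rw [Function.update_of_ne (by rintro rfl; exact hb ha)]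

/-- Positive integers `n i` factor as products of integers `m A` over the sets `A` containing `i`,
in such a way that the product of all `m A` is their least common multiple. -/
theorem exists_lcm_decomposition {ι : Type*} [DecidableEq ι] (n : ι → ℕ) (s : Finset ι) :
    (∀ i ∈ s, 0 < n i) → ∃ m : Finset ι → ℕ,
      (∀ i ∈ s, n i = ∏ A ∈ s.powerset, if i ∈ A then m A else 1) ∧
      s.lcm n = ∏ A ∈ s.powerset, m A ∧ m ∅ = 1 := by
  induction s using Finset.induction_on with
  | empty => intro _; exact ⟨fun _ => 1, by simp, by simp, rfl⟩
  | insert a s ha ih =>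
    intro hn
    obtain ⟨m, hm, hlcm, hm0⟩ := ih fun i hi => hn i (Finset.mem_insert_of_mem hi)
    obtain ⟨r, hr, hg⟩ := exists_dvd_eq_prod_of_dvd_prod s.powerset m (Nat.gcd (n a) (s.lcm n))
      (hlcm ▸ Nat.gcd_dvd_right _ _)
    set g := Nat.gcd (n a) (s.lcm n) with hgdef
    have hr0 : r ∅ = 1 := by simpa [hm0] using hr ∅ (by simp)
    have hgn : g ∣ n a := Nat.gcd_dvd_left _ _
    have hna : 0 < n a := hn a (by simp)
    have hgpos : 0 < g := Nat.gcd_pos_of_pos_left _ hna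
    -- Each old `m A` splits as `r A * (m A / r A)`: the part shared with `n a` moves to `insert a
    -- A`, the rest stays at `A`. The cofactor `n a / g`, new to the lcm, goes to `{a}`.
    let m' : Finset ι → ℕ := fun A =>
      if a ∈ A then r (A.erase a) * (if A.erase a = ∅ then n a / g else 1) else m A / r A
    have hnot : ∀ A ∈ s.powerset, a ∉ A := fun A hA h => ha (Finset.mem_powerset.1 hA h)
    have h1 : ∀ A ∈ s.powerset, m' A = m A / r A := fun A hA => by simp [m', hnot A hA]
    have h2 : ∀ A ∈ s.powerset, m' (insert a A) = r A * (if A = ∅ then n a / g else 1) :=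
      fun A hA => by simp [m', Finset.erase_insert (hnot A hA)]
    have h3 : ∏ A ∈ s.powerset, m' (insert a A) = n a := by
      rw [Finset.prod_congr rfl h2, Finset.prod_mul_distrib, ← hg, Finset.prod_ite_eq',
        if_pos (by simp), Nat.mul_div_cancel' hgn]
    have h4 : (∏ A ∈ s.powerset, m' A) * g = s.lcm n := by
      rw [hlcm, hg, ← Finset.prod_mul_distrib]
      refine Finset.prod_congr rfl fun A hA => ?_
      rw [h1 A hA, Nat.div_mul_cancel (hr A hA)]
    refine ⟨m', ?_, ?_, ?_⟩
    · intro i hi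
      rw [Finset.prod_powerset_insert ha]
      by_cases hia : i = a
      · subst hia
        rw [Finset.prod_eq_one fun A hA => if_neg (hnot A hA), one_mul]
        simpa using h3.symm
      · have his : i ∈ s := Finset.mem_of_mem_insert_of_ne hi hia
        rw [hm i his, ← Finset.prod_mul_distrib]
        refine Finset.prod_congr rfl fun A hA => ?_
        by_cases hiA : i ∈ A
        · have hne : A ≠ ∅ := by rintro rfl; simp at hiA
          rw [if_pos hiA, if_pos hiA, if_pos (Finset.mem_insert_of_mem hiA), h1 A hA, h2 A hA,
            if_neg hne, mul_one, Nat.div_mul_cancel (hr A hA)]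
        · rw [if_neg hiA, if_neg hiA, if_neg (by simp [hia, hiA]), mul_one]
    · rw [Finset.lcm_insert, Finset.prod_powerset_insert ha, h3]
      apply Nat.eq_of_mul_eq_mul_left hgpos
      have := Nat.gcd_mul_lcm (n a) (s.lcm n)
      rw [← hgdef] at this
      change g * Nat.lcm (n a) (s.lcm n) = _
      rw [this, ← h4]; ring
    · simp [m', hm0, hr0]

/-! ### Nonempty sets of indices. -/

/-- The sets of at least two indices. -/
abbrev LargeSet (k : ℕ) : Type := {A : Finset (Fin k) // 2 ≤ A.card}

/-- The nonempty sets of indices, presented as the large ones together with the singletons. -/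
def indexSet {k : ℕ} : LargeSet k ⊕ Fin k → Finset (Fin k) :=
  Sum.elim Subtype.val fun i => {i}

theorem indexSet_injective {k : ℕ} : Function.Injective (indexSet (k := k)) := by
  rintro (A | i) (B | j) h
  · exact congrArg _ (Subtype.ext h)
  · have := A.2
    simp only [indexSet, Sum.elim_inl, Sum.elim_inr] at h
    simp [h] at this
  · have := B.2
    simp only [indexSet, Sum.elim_inl, Sum.elim_inr] at h
    simp [← h] at this
  · simpa [indexSet] using h

theorem indexSet_nonempty {k : ℕ} (a : LargeSet k ⊕ Fin k) : (indexSet a).Nonempty := by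
  rcases a with A | i
  · exact Finset.card_pos.1 (lt_of_lt_of_le two_pos A.2)
  · exact Finset.singleton_nonempty i

theorem exists_indexSet_eq {k : ℕ} {A : Finset (Fin k)} (hA : A.Nonempty) :
    ∃ a, indexSet a = A := by
  rcases Nat.lt_or_ge A.card 2 with h | h
  · obtain ⟨i, rfl⟩ := Finset.card_eq_one.1 (Nat.le_antisymm (Nat.lt_succ_iff.1 h) hA.card_pos)
    exact ⟨Sum.inr i, rfl⟩
  · exact ⟨Sum.inl ⟨A, h⟩, rfl⟩

theorem image_indexSet (k : ℕ) :
    Finset.univ.image (indexSet (k := k)) = Finset.univ.erase ∅ := by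
  ext A
  simp only [Finset.mem_image, Finset.mem_univ, true_and, Finset.mem_erase, and_true]
  constructor
  · rintro ⟨a, rfl⟩
    exact (indexSet_nonempty a).ne_empty
  · exact fun h => exists_indexSet_eq (Finset.nonempty_iff_ne_empty.2 h)

theorem prod_indexSet {k : ℕ} (g : Finset (Fin k) → ℕ) (h : g ∅ = 1) :
    ∏ a, g (indexSet a) = ∏ A, g A := by
  rw [← Finset.prod_image (f := g) fun a _ b _ hab => indexSet_injective hab, image_indexSet,
    Finset.prod_erase _ h]

theorem card_largeSet_add (k : ℕ) : Fintype.card (LargeSet k) + k + 1 = 2 ^ k := by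
  have h := Finset.card_image_of_injective Finset.univ (indexSet_injective (k := k))
  rw [image_indexSet, Finset.card_erase_of_mem (Finset.mem_univ _), Finset.card_univ,
    Finset.card_univ, Fintype.card_finset, Fintype.card_fin, Fintype.card_sum,
    Fintype.card_fin] at h
  have := Nat.one_le_two_pow (n := k)
  omega

theorem card_largeSet (k : ℕ) : Fintype.card (LargeSet k) = 2 ^ k - k - 1 := by
  have := card_largeSet_add k
  omega

/-! ### Configurations, their tuples and weights. -/

/-- A positive integer for every large set of indices and for every index. -/
abbrev Config (k : ℕ) : Type := Σ _ : LargeSet k → ℕ, Fin k → ℕ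

namespace Config

/-- The coordinates of a configuration. -/
def coord {k : ℕ} (c : Config k) : LargeSet k ⊕ Fin k → ℕ := Sum.elim c.1 c.2

/-- The product of the integers attached to the large sets containing `i`. -/
def shared {k : ℕ} (m : LargeSet k → ℕ) (i : Fin k) : ℕ := ∏ A, if i ∈ A.1 then m A else 1

/-- The `k`-tuple defined by a configuration. -/
def tuple {k : ℕ} (c : Config k) (i : Fin k) : ℕ := c.2 i * shared c.1 i

/-- The product `∏ m_A ^ (|A| - 1)`. -/
noncomputable def weight {k : ℕ} (m : LargeSet k → ℕ) : ℝ := ∏ A, (m A : ℝ) ^ (A.1.card - 1)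

/-- The configurations with coordinates in `B` at the large sets, whose tuple is bounded by `N`. -/
def bounded (k : ℕ) (B : Finset ℕ) (N : ℕ) : Finset (Config k) :=
  (Fintype.piFinset fun _ => B).sigma fun m =>
    Fintype.piFinset fun i => Finset.Icc 1 (N / shared m i)

variable {k : ℕ}

theorem weight_nonneg (m : LargeSet k → ℕ) : 0 ≤ weight m :=
  Finset.prod_nonneg fun _ _ => by positivity

theorem shared_pos {m : LargeSet k → ℕ} (hm : ∀ A, 0 < m A) (i : Fin k) : 0 < shared m i :=
  Finset.prod_pos fun A _ => by split_ifs <;> simp [hm A]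

theorem tuple_eq_prod (c : Config k) (i : Fin k) :
    c.tuple i = ∏ a, if i ∈ indexSet a then c.coord a else 1 := by
  have h : ∏ j, (if i ∈ indexSet (Sum.inr j : LargeSet k ⊕ Fin k) then c.coord (Sum.inr j) else 1) =
      c.2 i := by
    simp [indexSet, coord]
  rw [Fintype.prod_sum_type, h, mul_comm]
  rfl

theorem coord_pos {B : Finset ℕ} (hB : ∀ b ∈ B, 0 < b) {N : ℕ} {c : Config k}
    (hc : c ∈ bounded k B N) (a : LargeSet k ⊕ Fin k) : 0 < c.coord a := by
  rw [bounded, Finset.mem_sigma, Fintype.mem_piFinset, Fintype.mem_piFinset] at hc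
  rcases a with A | i
  · exact hB _ (hc.1 A)
  · exact (Finset.mem_Icc.1 (hc.2 i)).1

theorem coord_le {B : Finset ℕ} {N : ℕ} (hB : ∀ b ∈ B, b ≤ N) {c : Config k}
    (hc : c ∈ bounded k B N) (a : LargeSet k ⊕ Fin k) : c.coord a ≤ N := by
  rw [bounded, Finset.mem_sigma, Fintype.mem_piFinset, Fintype.mem_piFinset] at hc
  rcases a with A | i
  · exact hB _ (hc.1 A)
  · exact (Finset.mem_Icc.1 (hc.2 i)).2.trans (Nat.div_le_self _ _)

theorem tuple_mem {B : Finset ℕ} (hB : ∀ b ∈ B, 0 < b) {N : ℕ} {c : Config k}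
    (hc : c ∈ bounded k B N) : c.tuple ∈ Fintype.piFinset fun _ : Fin k => Finset.Icc 1 N := by
  have hpos := coord_pos hB hc
  rw [bounded, Finset.mem_sigma, Fintype.mem_piFinset, Fintype.mem_piFinset] at hc
  have hs := shared_pos fun A => hpos (Sum.inl A)
  rw [Fintype.mem_piFinset]
  intro i
  rw [Finset.mem_Icc]
  exact ⟨Nat.mul_pos (hpos (Sum.inr i)) (hs i),
    (Nat.le_div_iff_mul_le (hs i)).1 (Finset.mem_Icc.1 (hc.2 i)).2⟩

/-- Each `m A` occurs in exactly `|A|` of the products `shared m i`. -/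
theorem weight_mul_prod (m : LargeSet k → ℕ) :
    weight m * ∏ A, (m A : ℝ) = ∏ i, (shared m i : ℝ) := by
  have h : ∀ i, (shared m i : ℝ) = ∏ A, if i ∈ A.1 then (m A : ℝ) else 1 := fun i => by
    rw [shared, Nat.cast_prod]
    exact Finset.prod_congr rfl fun A _ => by split_ifs <;> simp
  rw [Finset.prod_congr rfl fun i _ => h i, Finset.prod_comm, weight, ← Finset.prod_mul_distrib]
  refine Finset.prod_congr rfl fun A _ => ?_
  rw [Finset.prod_ite_mem, Finset.univ_inter, Finset.prod_const, ← pow_succ,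
    Nat.sub_add_cancel (one_le_two.trans A.2)]

theorem weight_mul_prod_coord (c : Config k) :
    weight c.1 * ∏ a, (c.coord a : ℝ) = ∏ i, (c.tuple i : ℝ) := by
  rw [Fintype.prod_sum_type]
  simp only [coord, Sum.elim_inl, Sum.elim_inr, tuple, Nat.cast_mul]
  rw [← mul_assoc, weight_mul_prod, Finset.prod_mul_distrib, mul_comm]

theorem lcm_tuple_dvd (c : Config k) : Finset.univ.lcm c.tuple ∣ ∏ a, c.coord a := by
  refine Finset.lcm_dvd fun i _ => ?_
  rw [tuple_eq_prod]
  exact Finset.prod_dvd_prod_of_dvd _ _ fun a _ => by split_ifs <;> simp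

theorem prodDivLcm_tuple {c : Config k} (hc : ∀ a, 0 < c.coord a)
    (h : Finset.univ.lcm c.tuple = ∏ a, c.coord a) : prodDivLcm c.tuple = weight c.1 := by
  have h0 : (∏ a, (c.coord a : ℝ)) ≠ 0 :=
    Finset.prod_ne_zero_iff.2 fun a _ => Nat.cast_ne_zero.2 (hc a).ne'
  rw [prodDivLcm, h, Nat.cast_prod, ← weight_mul_prod_coord, mul_div_cancel_right₀ _ h0]

theorem weight_le_prodDivLcm_tuple {c : Config k} (hc : ∀ a, 0 < c.coord a) :
    weight c.1 ≤ prodDivLcm c.tuple := by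
  have h0 : 0 < ∏ a, c.coord a := Finset.prod_pos fun a _ => hc a
  have h1 : 0 < Finset.univ.lcm c.tuple := Nat.pos_of_dvd_of_pos (lcm_tuple_dvd c) h0
  rw [prodDivLcm, ← weight_mul_prod_coord, le_div_iff₀ (Nat.cast_pos.2 h1), ← Nat.cast_prod]
  exact mul_le_mul_of_nonneg_left (Nat.cast_le.2 (Nat.le_of_dvd h0 (lcm_tuple_dvd c)))
    (weight_nonneg _)

/-- The lcm decomposition supplies the configuration; every coordinate belongs to a nonempty set, so
it divides some `n i` and is at most `N`. -/
theorem exists_mem_bounded {N : ℕ} {n : Fin k → ℕ}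
    (hn : n ∈ Fintype.piFinset fun _ : Fin k => Finset.Icc 1 N) :
    ∃ c ∈ bounded k (Finset.Icc 1 N) N, c.tuple = n ∧ prodDivLcm n = weight c.1 := by
  rw [Fintype.mem_piFinset] at hn
  have hn1 : ∀ i, 0 < n i := fun i => (Finset.mem_Icc.1 (hn i)).1
  obtain ⟨m, hm, hlcm, hm0⟩ := exists_lcm_decomposition n Finset.univ fun i _ => hn1 i
  rw [Finset.powerset_univ] at hm hlcm
  let c : Config k := ⟨fun A => m A.1, fun i => m {i}⟩
  have hcoord : ∀ a, c.coord a = m (indexSet a) := by rintro (A | i) <;> rfl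
  have htuple : c.tuple = n := by
    funext i
    rw [tuple_eq_prod, hm i (Finset.mem_univ i),
      ← prod_indexSet (fun A => if i ∈ A then m A else 1) (by simp)]
    exact Finset.prod_congr rfl fun a _ => by rw [hcoord]
  have hdvd : ∀ a, ∃ i, c.coord a ∣ n i := fun a => by
    obtain ⟨i, hi⟩ := indexSet_nonempty a
    refine ⟨i, ?_⟩
    rw [← htuple, tuple_eq_prod]
    have := Finset.dvd_prod_of_mem (fun a => if i ∈ indexSet a then c.coord a else 1)
      (Finset.mem_univ a)
    simpa only [if_pos hi] using this
  have hpos : ∀ a, 0 < c.coord a := fun a => by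
    obtain ⟨i, hi⟩ := hdvd a
    exact Nat.pos_of_dvd_of_pos hi (hn1 i)
  have hle : ∀ a, c.coord a ≤ N := fun a => by
    obtain ⟨i, hi⟩ := hdvd a
    exact (Nat.le_of_dvd (hn1 i) hi).trans (Finset.mem_Icc.1 (hn i)).2
  refine ⟨c, ?_, htuple, ?_⟩
  · rw [bounded, Finset.mem_sigma, Fintype.mem_piFinset, Fintype.mem_piFinset]
    refine ⟨fun A => Finset.mem_Icc.2 ⟨hpos (Sum.inl A), hle (Sum.inl A)⟩,
      fun i => Finset.mem_Icc.2 ⟨hpos (Sum.inr i), ?_⟩⟩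
    refine (Nat.le_div_iff_mul_le (shared_pos (fun A => hpos (Sum.inl A)) i)).2 ?_
    change c.tuple i ≤ N
    rw [htuple]
    exact (Finset.mem_Icc.1 (hn i)).2
  · conv_lhs => rw [← htuple]
    refine prodDivLcm_tuple hpos ?_
    rw [htuple, hlcm, ← prod_indexSet m hm0]
    exact Finset.prod_congr rfl fun a _ => (hcoord a).symm

/-! ### Weighted counts of configurations. -/

theorem sum_prod_inv (S : LargeSet k → Finset ℕ) :
    ∑ m ∈ Fintype.piFinset S, ∏ A, (m A : ℝ)⁻¹ = ∏ A, ∑ b ∈ S A, (b : ℝ)⁻¹ :=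
  (Finset.prod_univ_sum S fun _ b => (b : ℝ)⁻¹).symm

theorem weight_mul_prod_inv_shared {m : LargeSet k → ℕ} (hm : ∀ A, 0 < m A) :
    weight m * ∏ i, (shared m i : ℝ)⁻¹ = ∏ A, (m A : ℝ)⁻¹ := by
  have h0 : (∏ A, (m A : ℝ)) ≠ 0 :=
    Finset.prod_ne_zero_iff.2 fun a _ => Nat.cast_ne_zero.2 (hm a).ne'
  have h1 : weight m ≠ 0 :=
    Finset.prod_ne_zero_iff.2 fun a _ => pow_ne_zero _ (Nat.cast_ne_zero.2 (hm a).ne')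
  rw [Finset.prod_inv_distrib, Finset.prod_inv_distrib, ← weight_mul_prod]
  field_simp

/-- Requiring `d a` to divide a coordinate costs a factor `1 / d a`, independently over coordinates.
With `d = 1` this gives the upper bound; with `d = p` at two places it bounds the discarded
configurations. -/
theorem sum_weight_filter_dvd_le {B : Finset ℕ} (hB : ∀ b ∈ B, 0 < b)
    (hdvd : ∀ b ∈ B, ∀ e, e ∣ b → e ∈ B) (N : ℕ) (d : LargeSet k ⊕ Fin k → ℕ)
    (hd : ∀ a, 0 < d a) :
    ∑ c ∈ bounded k B N with ∀ a, d a ∣ c.coord a, weight c.1 ≤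
      (N : ℝ) ^ k * (∑ b ∈ B, (b : ℝ)⁻¹) ^ Fintype.card (LargeSet k) * ∏ a, (d a : ℝ)⁻¹ := by
  have hset : (bounded k B N).filter (fun c => ∀ a, d a ∣ c.coord a) =
      (Fintype.piFinset fun A => B.filter (d (Sum.inl A) ∣ ·)).sigma fun m =>
        Fintype.piFinset fun i => (Finset.Icc 1 (N / shared m i)).filter (d (Sum.inr i) ∣ ·) := by
    ext c
    simp only [bounded, Finset.mem_filter, Finset.mem_sigma, Fintype.mem_piFinset, Sum.forall,
      coord, Sum.elim_inl, Sum.elim_inr]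
    constructor
    · exact fun h => ⟨fun A => ⟨h.1.1 A, h.2.1 A⟩, fun i => ⟨h.1.2 i, h.2.2 i⟩⟩
    · exact fun h => ⟨⟨fun A => (h.1 A).1, fun i => (h.2 i).1⟩, fun A => (h.1 A).2,
        fun i => (h.2 i).2⟩
  have hcard : ∀ e n : ℕ, ((Finset.Icc 1 n).filter (e ∣ ·)).card = n / e := fun e n =>
    Nat.Ioc_filter_dvd_card_eq_div n e
  -- Divisor-closedness enters here: `b ↦ b / e` maps the multiples of `e` in `B` injectively into
  -- `B`.
  have hH : ∀ e, 0 < e → ∑ b ∈ B with e ∣ b, (b : ℝ)⁻¹ ≤ (∑ b ∈ B, (b : ℝ)⁻¹) * (e : ℝ)⁻¹ := by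
    intro e he
    have hinj : Set.InjOn (fun b => b / e) (B.filter (e ∣ ·) : Finset ℕ) := by
      intro b hb b' hb' h
      rw [Finset.mem_coe, Finset.mem_filter] at hb hb'
      rw [← Nat.div_mul_cancel hb.2, ← Nat.div_mul_cancel hb'.2]
      exact congrArg (· * e) h
    rw [Finset.sum_mul]
    calc ∑ b ∈ B with e ∣ b, (b : ℝ)⁻¹
        = ∑ b ∈ B with e ∣ b, ((b / e : ℕ) : ℝ)⁻¹ * (e : ℝ)⁻¹ := by
          refine Finset.sum_congr rfl fun b hb => ?_
          rw [← mul_inv, ← Nat.cast_mul, Nat.div_mul_cancel (Finset.mem_filter.1 hb).2]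
      _ = ∑ b ∈ (B.filter (e ∣ ·)).image (fun b => b / e), (b : ℝ)⁻¹ * (e : ℝ)⁻¹ :=
          (Finset.sum_image (f := fun b : ℕ => (b : ℝ)⁻¹ * (e : ℝ)⁻¹) hinj).symm
      _ ≤ ∑ b ∈ B, (b : ℝ)⁻¹ * (e : ℝ)⁻¹ := by
          refine Finset.sum_le_sum_of_subset_of_nonneg ?_ fun _ _ _ => by positivity
          intro b hb
          obtain ⟨b', hb', rfl⟩ := Finset.mem_image.1 hb
          rw [Finset.mem_filter] at hb'
          exact hdvd b' hb'.1 _ (Nat.div_dvd_of_dvd hb'.2)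
  rw [hset, Finset.sum_sigma]
  calc _ ≤ ∑ m ∈ Fintype.piFinset fun A => B.filter (d (Sum.inl A) ∣ ·),
        ((N : ℝ) ^ k * ∏ i, (d (Sum.inr i) : ℝ)⁻¹) * ∏ A, (m A : ℝ)⁻¹ := by
        refine Finset.sum_le_sum fun m hm => ?_
        rw [Fintype.mem_piFinset] at hm
        change ∑ _ ∈ _, weight m ≤ _
        rw [Finset.sum_const, nsmul_eq_mul, Fintype.card_piFinset,
          ← weight_mul_prod_inv_shared fun A => hB _ (Finset.mem_filter.1 (hm A)).1]
        have : (N : ℝ) ^ k = ∏ _i : Fin k, (N : ℝ) := by simp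
        rw [mul_comm, mul_left_comm, this, ← Finset.prod_mul_distrib, ← Finset.prod_mul_distrib]
        refine mul_le_mul_of_nonneg_left ?_ (weight_nonneg _)
        rw [Nat.cast_prod]
        refine Finset.prod_le_prod (fun _ _ => Nat.cast_nonneg _) fun i _ => ?_
        rw [hcard, Nat.div_div_eq_div_mul]
        refine Nat.cast_div_le.trans_eq ?_
        rw [Nat.cast_mul, div_eq_mul_inv, mul_inv]
        ring
    _ ≤ _ := by
        have h : ∏ A, ∑ b ∈ B with d (Sum.inl A) ∣ b, (b : ℝ)⁻¹ ≤
            (∑ b ∈ B, (b : ℝ)⁻¹) ^ Fintype.card (LargeSet k) *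
              ∏ A, (d (Sum.inl A) : ℝ)⁻¹ := by
          rw [← Finset.card_univ, ← Finset.prod_const, ← Finset.prod_mul_distrib]
          exact Finset.prod_le_prod (fun _ _ => Finset.sum_nonneg fun _ _ => by positivity)
            fun A _ => hH _ (hd _)
        have h0 : 0 ≤ (N : ℝ) ^ k * ∏ i, (d (Sum.inr i) : ℝ)⁻¹ := by positivity
        rw [← Finset.mul_sum, sum_prod_inv, Fintype.prod_sum_type (fun a => (d a : ℝ)⁻¹)]
        refine (mul_le_mul_of_nonneg_left h h0).trans_eq ?_
        ring

end Config

namespace Config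

variable {k : ℕ}

/-! ### The upper bound by harmonic sums. -/

theorem sum_prodDivLcm_le (k N : ℕ) :
    ∑ n ∈ Fintype.piFinset (fun _ : Fin k => Finset.Icc 1 N), prodDivLcm n ≤
      (N : ℝ) ^ k * (∑ b ∈ Finset.Icc 1 N, (b : ℝ)⁻¹) ^ Fintype.card (LargeSet k) := by
  choose! φ hφ hφt hφw using fun n => exists_mem_bounded (k := k) (N := N) (n := n)
  have hinj : Set.InjOn φ (Fintype.piFinset fun _ : Fin k => Finset.Icc 1 N : Finset _) :=
    fun n hn n' hn' h => by rw [← hφt n hn, ← hφt n' hn', h]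
  calc _ = ∑ n ∈ Fintype.piFinset (fun _ : Fin k => Finset.Icc 1 N), weight (φ n).1 :=
        Finset.sum_congr rfl hφw
    _ = ∑ c ∈ (Fintype.piFinset fun _ : Fin k => Finset.Icc 1 N).image φ, weight c.1 :=
        (Finset.sum_image (f := fun c : Config k => weight c.1) hinj).symm
    _ ≤ ∑ c ∈ bounded k (Finset.Icc 1 N) N, weight c.1 :=
        Finset.sum_le_sum_of_subset_of_nonneg (Finset.image_subset_iff.2 hφ)
          fun _ _ _ => weight_nonneg _
    _ ≤ _ := by
        have := sum_weight_filter_dvd_le (k := k) (B := Finset.Icc 1 N)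
          (fun b hb => (Finset.mem_Icc.1 hb).1)
          (fun b hb e he => by
            rw [Finset.mem_Icc] at hb ⊢
            exact ⟨Nat.pos_of_dvd_of_pos he hb.1, (Nat.le_of_dvd hb.1 he).trans hb.2⟩)
          N (fun _ => 1) (fun _ => one_pos)
        simpa using this

/-! ### The lower bound: configurations determined by their tuples. -/

theorem le_sum_weight {B : Finset ℕ} (hB : ∀ b ∈ B, 0 < b) {N z : ℕ} (hz : ∀ b ∈ B, b ≤ z)
    (hz1 : 1 ≤ z) (hzN : z ^ 2 ^ k ≤ N) :
    ((N : ℝ) / 2) ^ k * (∑ b ∈ B, (b : ℝ)⁻¹) ^ Fintype.card (LargeSet k) ≤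
      ∑ c ∈ bounded k B N, weight c.1 := by
  rw [bounded, Finset.sum_sigma, ← Finset.card_univ, ← Finset.prod_const, ← sum_prod_inv,
    Finset.mul_sum]
  refine Finset.sum_le_sum fun m hm => ?_
  rw [Fintype.mem_piFinset] at hm
  have hm0 : ∀ A, 0 < m A := fun A => hB _ (hm A)
  have hs : ∀ i, shared m i ≤ N := fun i => by
    calc shared m i ≤ ∏ _A : LargeSet k, z :=
          Finset.prod_le_prod' fun A _ => by split_ifs <;> [exact hz _ (hm A); exact hz1]
      _ = z ^ Fintype.card (LargeSet k) := by rw [Finset.prod_const, Finset.card_univ]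
      _ ≤ z ^ 2 ^ k := Nat.pow_le_pow_right hz1 (by have := card_largeSet_add k; omega)
      _ ≤ N := hzN
  change _ ≤ ∑ _ ∈ _, weight m
  rw [Finset.sum_const, nsmul_eq_mul, Fintype.card_piFinset, ← weight_mul_prod_inv_shared hm0]
  have hN : ((N : ℝ) / 2) ^ k = ∏ _i : Fin k, (N : ℝ) / 2 := by
    rw [Finset.prod_const, Finset.card_univ, Fintype.card_fin]
  rw [mul_left_comm, mul_comm _ (weight m), hN, ← Finset.prod_mul_distrib, Nat.cast_prod]
  refine mul_le_mul_of_nonneg_left ?_ (weight_nonneg _)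
  refine Finset.prod_le_prod (fun _ _ => by positivity) fun i _ => ?_
  have hi := shared_pos hm0 i
  -- A quotient that is at least 1 loses at most a factor 2 when rounded down; this is the source of
  -- `(N / 2) ^ k`.
  have h1 : 1 ≤ N / shared m i := (Nat.one_le_div_iff hi).2 (hs i)
  have h2 : N < shared m i * (N / shared m i + 1) := Nat.lt_mul_div_succ N hi
  have h3 : N ≤ 2 * (N / shared m i) * shared m i := by nlinarith
  have h4 : (N : ℝ) ≤ 2 * (N / shared m i : ℕ) * shared m i := by exact_mod_cast h3
  rw [Nat.card_Icc, Nat.add_sub_cancel, ← div_eq_mul_inv, div_le_iff₀ (Nat.cast_pos.2 hi)]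
  linarith

/-- No prime exceeding `P` divides two coordinates. -/
def IsCoprimeAbove (P : ℕ) (c : Config k) : Prop :=
  ∀ p, P < p → p.Prime → ∀ a b, p ∣ c.coord a → p ∣ c.coord b → a = b

/-- Applied to the valuations of the coordinates at one prime. When at most one coordinate is
nonzero, the sums equal its value on its index set and vanish elsewhere, so they reveal both the set
and the value. -/
theorem eq_of_sum_indexSet_eq {v v' : LargeSet k ⊕ Fin k → ℕ}
    (hv : ∀ a b, v a ≠ 0 → v b ≠ 0 → a = b) (hv' : ∀ a b, v' a ≠ 0 → v' b ≠ 0 → a = b)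
    (h : ∀ i, ∑ a, (if i ∈ indexSet a then v a else 0) =
      ∑ a, if i ∈ indexSet a then v' a else 0) : v = v' := by
  have key : ∀ u : LargeSet k ⊕ Fin k → ℕ, (∀ a b, u a ≠ 0 → u b ≠ 0 → a = b) → ∀ a, u a ≠ 0 →
      ∀ i, ∑ b, (if i ∈ indexSet b then u b else 0) = if i ∈ indexSet a then u a else 0 := by
    intro u hu a ha i
    refine Finset.sum_eq_single a (fun b _ hb => ?_) (by simp)
    have : u b = 0 := by
      by_contra h0
      exact hb (hu b a h0 ha)
    simp [this]
  have main : ∀ u u' : LargeSet k ⊕ Fin k → ℕ, (∀ a b, u a ≠ 0 → u b ≠ 0 → a = b) →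
      (∀ a b, u' a ≠ 0 → u' b ≠ 0 → a = b) →
      (∀ i, ∑ a, (if i ∈ indexSet a then u a else 0) =
        ∑ a, if i ∈ indexSet a then u' a else 0) → ∀ a, u a ≠ 0 → u a = u' a := by
    intro u u' hu hu' huu a ha
    obtain ⟨i, hi⟩ := indexSet_nonempty a
    have h1 := huu i
    rw [key u hu a ha, if_pos hi] at h1
    obtain ⟨b, -, hb⟩ := Finset.exists_ne_zero_of_sum_ne_zero (h1 ▸ ha)
    have hb0 : u' b ≠ 0 := fun h0 => hb (by simp [h0])
    have hab : a = b := by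
      apply indexSet_injective
      ext j
      have h2 := huu j
      rw [key u hu a ha, key u' hu' b hb0] at h2
      refine ⟨fun hja => by_contra fun hjb => ha ?_, fun hjb => by_contra fun hja => hb0 ?_⟩
      · rwa [if_pos hja, if_neg hjb] at h2
      · rw [if_neg hja, if_pos hjb] at h2
        exact h2.symm
    subst hab
    rw [key u' hu' a hb0, if_pos hi] at h1
    exact h1
  funext a
  by_cases ha : v a = 0
  · by_cases ha' : v' a = 0
    · rw [ha, ha']
    · exact (main v' v hv' hv (fun i => (h i).symm) a ha').symm
  · exact main v v' hv hv' h a ha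

theorem factorization_tuple {c : Config k} (hc : ∀ a, 0 < c.coord a) (i : Fin k) (p : ℕ) :
    (c.tuple i).factorization p =
      ∑ a, if i ∈ indexSet a then (c.coord a).factorization p else 0 := by
  rw [tuple_eq_prod, Nat.factorization_prod fun a _ => by
    split_ifs <;> [exact (hc a).ne'; exact one_ne_zero], Finsupp.finsetSum_apply]
  exact Finset.sum_congr rfl fun a _ => by split_ifs <;> simp

/-- Only primes `> P` divide the large coordinates, and there the tuple determines all valuations.
The singleton coordinates, which may have small prime factors, are then recovered by cancelling
`shared`. -/
theorem injOn_tuple {B : Finset ℕ} (hB : ∀ b ∈ B, 0 < b) {P : ℕ}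
    (hP : ∀ b ∈ B, ∀ p, p.Prime → p ∣ b → P < p) {N : ℕ} {c c' : Config k}
    (hc : c ∈ bounded k B N) (hc' : c' ∈ bounded k B N) (hcP : c.IsCoprimeAbove P)
    (hcP' : c'.IsCoprimeAbove P) (h : c.tuple = c'.tuple) : c = c' := by
  have hpos := coord_pos hB hc
  have hpos' := coord_pos hB hc'
  have hmem := fun A => (Fintype.mem_piFinset.1 (Finset.mem_sigma.1 hc).1) A
  have hmem' := fun A => (Fintype.mem_piFinset.1 (Finset.mem_sigma.1 hc').1) A
  have hunique : ∀ (e : Config k) (p : ℕ), e.IsCoprimeAbove P → P < p → p.Prime → ∀ a b,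
      (e.coord a).factorization p ≠ 0 → (e.coord b).factorization p ≠ 0 → a = b :=
    fun e p he hp hpp a b ha hb => he p hp hpp a b (Nat.dvd_of_factorization_pos ha)
      (Nat.dvd_of_factorization_pos hb)
  have h1 : c.1 = c'.1 := by
    funext A
    refine Nat.eq_of_factorization_eq (hpos (Sum.inl A)).ne' (hpos' (Sum.inl A)).ne' fun p => ?_
    by_cases hp : p.Prime
    · by_cases hPp : P < p
      · have := eq_of_sum_indexSet_eq (hunique c p hcP hPp hp) (hunique c' p hcP' hPp hp)
          fun i => by rw [← factorization_tuple hpos, ← factorization_tuple hpos', h]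
        exact congrFun this (Sum.inl A)
      · rw [Nat.factorization_eq_zero_of_not_dvd fun hd => hPp (hP _ (hmem A) p hp hd),
          Nat.factorization_eq_zero_of_not_dvd fun hd => hPp (hP _ (hmem' A) p hp hd)]
    · rw [Nat.factorization_eq_zero_of_not_prime _ hp, Nat.factorization_eq_zero_of_not_prime _ hp]
  obtain ⟨m, q⟩ := c
  obtain ⟨m', q'⟩ := c'
  obtain rfl : m = m' := h1
  have h2 : q = q' := by
    funext i
    exact Nat.eq_of_mul_eq_mul_right (shared_pos (fun A => hpos (Sum.inl A)) i) (congrFun h i)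
  rw [h2]

-- A union bound over pairs of distinct coordinates and integers `p` with `P < p ≤ N`: each event
-- has weight at most `p⁻²` of the main term. There are at most `4 ^ k` ordered pairs, and primality
-- of `p` is not needed.
open Classical in
theorem sum_weight_not_isCoprimeAbove_le {B : Finset ℕ} (hB : ∀ b ∈ B, 0 < b)
    (hdvd : ∀ b ∈ B, ∀ e, e ∣ b → e ∈ B) {N P : ℕ} (hBN : ∀ b ∈ B, b ≤ N) (hP : 0 < P) :
    ∑ c ∈ bounded k B N with ¬ c.IsCoprimeAbove P, weight c.1 ≤
      4 ^ k / P * ((N : ℝ) ^ k * (∑ b ∈ B, (b : ℝ)⁻¹) ^ Fintype.card (LargeSet k)) := by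
  set T := (N : ℝ) ^ k * (∑ b ∈ B, (b : ℝ)⁻¹) ^ Fintype.card (LargeSet k) with hT
  have hT0 : 0 ≤ T := by positivity
  let pairs : Finset ((LargeSet k ⊕ Fin k) × (LargeSet k ⊕ Fin k)) := Finset.univ.offDiag
  have hpair : ∀ p ∈ Finset.Ioc P N, ∀ t ∈ pairs,
      ∑ c ∈ bounded k B N with p ∣ c.coord t.1 ∧ p ∣ c.coord t.2, weight c.1 ≤
        T * ((p : ℝ) ^ 2)⁻¹ := by
    intro p hp t ht
    have hp0 : 0 < p := (Nat.zero_le _).trans_lt (Finset.mem_Ioc.1 hp).1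
    have hne : t.1 ≠ t.2 := (Finset.mem_offDiag.1 ht).2.2
    have hmain := sum_weight_filter_dvd_le hB hdvd N
      (fun a => if a ∈ ({t.1, t.2} : Finset _) then p else 1)
      (fun a => by split_ifs <;> [exact hp0; exact one_pos])
    have hprod : ∏ a, (((if a ∈ ({t.1, t.2} : Finset (LargeSet k ⊕ Fin k)) then p else 1 : ℕ)) : ℝ)⁻¹
        = ((p : ℝ) ^ 2)⁻¹ := by
      have : ∀ a, (((if a ∈ ({t.1, t.2} : Finset (LargeSet k ⊕ Fin k)) then p else 1 : ℕ)) : ℝ)⁻¹ =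
          if a ∈ ({t.1, t.2} : Finset (LargeSet k ⊕ Fin k)) then (p : ℝ)⁻¹ else 1 := fun a => by
        split_ifs <;> simp
      rw [Finset.prod_congr rfl fun a _ => this a, Finset.prod_ite_mem, Finset.univ_inter,
        Finset.prod_const, Finset.card_pair hne, inv_pow]
    rw [hprod] at hmain
    refine le_trans (le_of_eq ?_) hmain
    refine Finset.sum_congr (Finset.filter_congr fun c _ => ?_) fun _ _ => rfl
    constructor
    · rintro ⟨h1, h2⟩ a
      by_cases ha : a ∈ ({t.1, t.2} : Finset _)
      · rw [if_pos ha]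
        rcases Finset.mem_insert.1 ha with rfl | ha
        · exact h1
        · rwa [Finset.mem_singleton.1 ha]
      · rw [if_neg ha]
        exact one_dvd _
    · intro h
      have h1 := h t.1
      have h2 := h t.2
      simp only [Finset.mem_insert, Finset.mem_singleton, true_or, or_true, if_true] at h1 h2
      exact ⟨h1, h2⟩
  calc ∑ c ∈ bounded k B N with ¬ c.IsCoprimeAbove P, weight c.1
      ≤ ∑ c ∈ bounded k B N, ∑ u ∈ Finset.Ioc P N ×ˢ pairs,
          if u.1 ∣ c.coord u.2.1 ∧ u.1 ∣ c.coord u.2.2 then weight c.1 else 0 := by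
        have hnn : ∀ c : Config k, ∀ u ∈ Finset.Ioc P N ×ˢ pairs,
            0 ≤ if u.1 ∣ c.coord u.2.1 ∧ u.1 ∣ c.coord u.2.2 then weight c.1 else 0 :=
          fun c u _ => by split_ifs <;> [exact weight_nonneg _; exact le_rfl]
        rw [Finset.sum_filter]
        refine Finset.sum_le_sum fun c hc => ?_
        split_ifs with hcP
        · exact Finset.sum_nonneg (hnn c)
        · rw [IsCoprimeAbove] at hcP
          push Not at hcP
          obtain ⟨p, hPp, -, a, b, ha, hb, hab⟩ := hcP
          have hpN : p ≤ N := (Nat.le_of_dvd (coord_pos hB hc a) ha).trans (coord_le hBN hc a)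
          have hu : (p, (a, b)) ∈ Finset.Ioc P N ×ˢ pairs := by
            simp [pairs, hPp, hpN, hab]
          refine le_trans (le_of_eq ?_) (Finset.single_le_sum (hnn c) hu)
          rw [if_pos ⟨ha, hb⟩]
    _ = ∑ u ∈ Finset.Ioc P N ×ˢ pairs,
          ∑ c ∈ bounded k B N with u.1 ∣ c.coord u.2.1 ∧ u.1 ∣ c.coord u.2.2, weight c.1 := by
        rw [Finset.sum_comm]
        exact Finset.sum_congr rfl fun u _ => (Finset.sum_filter _ _).symm
    _ ≤ ∑ u ∈ Finset.Ioc P N ×ˢ pairs, T * ((u.1 : ℝ) ^ 2)⁻¹ :=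
        Finset.sum_le_sum fun u hu =>
          hpair u.1 (Finset.mem_product.1 hu).1 u.2 (Finset.mem_product.1 hu).2
    _ = pairs.card * T * ∑ p ∈ Finset.Ioc P N, ((p : ℝ) ^ 2)⁻¹ := by
        rw [Finset.sum_product, Finset.mul_sum]
        exact Finset.sum_congr rfl fun p _ => by
          change ∑ _ ∈ pairs, T * ((p : ℝ) ^ 2)⁻¹ = _
          rw [Finset.sum_const, nsmul_eq_mul, ← mul_assoc]
    _ ≤ 4 ^ k * T * (P : ℝ)⁻¹ := by
        have hcard : (pairs.card : ℝ) ≤ 4 ^ k := by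
          have h1 : Fintype.card (LargeSet k ⊕ Fin k) ≤ 2 ^ k := by
            rw [Fintype.card_sum, Fintype.card_fin]
            have := card_largeSet_add k
            omega
          have h2 : pairs.card ≤ 4 ^ k := by
            calc pairs.card ≤ (2 ^ k) * (2 ^ k) := by
                  rw [Finset.offDiag_card, Finset.card_univ]
                  exact (Nat.sub_le _ _).trans (Nat.mul_le_mul h1 h1)
              _ = 4 ^ k := (mul_pow 2 2 k).symm
          exact_mod_cast h2
        have hsum : ∑ p ∈ Finset.Ioc P N, ((p : ℝ) ^ 2)⁻¹ ≤ (P : ℝ)⁻¹ := by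
          rcases le_total P N with h | h
          · exact (sum_Ioc_inv_sq_le_sub hP.ne' h).trans (sub_le_self _ (by positivity))
          · rw [Finset.Ioc_eq_empty_of_le h, Finset.sum_empty]
            positivity
        gcongr
    _ = 4 ^ k / P * T := by ring

theorem prodDivLcm_nonneg (n : Fin k → ℕ) : 0 ≤ prodDivLcm n :=
  div_nonneg (Finset.prod_nonneg fun _ _ => Nat.cast_nonneg _) (Nat.cast_nonneg _)

theorem le_sum_prodDivLcm {B : Finset ℕ} (hB : ∀ b ∈ B, 0 < b)
    (hdvd : ∀ b ∈ B, ∀ e, e ∣ b → e ∈ B) {N P z : ℕ} (hz : ∀ b ∈ B, b ≤ z) (hz1 : 1 ≤ z)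
    (hzN : z ^ 2 ^ k ≤ N) (hP : 4 ^ k * 2 ^ (k + 1) ≤ P)
    (hBP : ∀ b ∈ B, ∀ p, p.Prime → p ∣ b → P < p) :
    (2 ^ (k + 1) : ℝ)⁻¹ * ((N : ℝ) ^ k * (∑ b ∈ B, (b : ℝ)⁻¹) ^ Fintype.card (LargeSet k)) ≤
      ∑ n ∈ Fintype.piFinset (fun _ : Fin k => Finset.Icc 1 N), prodDivLcm n := by
  classical
  have hP0 : 0 < P := lt_of_lt_of_le (by positivity) hP
  have hzN' : z ≤ N := (Nat.le_self_pow (by positivity) z).trans hzN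
  have hall := le_sum_weight hB hz hz1 hzN
  have hbad := sum_weight_not_isCoprimeAbove_le (k := k) hB hdvd
    (fun b hb => (hz b hb).trans hzN') hP0
  rw [← Finset.sum_filter_add_sum_filter_not _ (IsCoprimeAbove P)] at hall
  have hgood : ∑ c ∈ bounded k B N with c.IsCoprimeAbove P, weight c.1 ≤
      ∑ n ∈ Fintype.piFinset (fun _ : Fin k => Finset.Icc 1 N), prodDivLcm n := by
    calc _ ≤ ∑ c ∈ bounded k B N with c.IsCoprimeAbove P, prodDivLcm c.tuple :=
          Finset.sum_le_sum fun c hc =>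
            weight_le_prodDivLcm_tuple (coord_pos hB (Finset.mem_filter.1 hc).1)
      _ = ∑ n ∈ ((bounded k B N).filter (IsCoprimeAbove P)).image tuple, prodDivLcm n := by
          refine (Finset.sum_image fun c hc c' hc' h => ?_).symm
          rw [Finset.mem_coe, Finset.mem_filter] at hc hc'
          exact injOn_tuple hB hBP hc.1 hc'.1 hc.2 hc'.2 h
      _ ≤ _ := by
          refine Finset.sum_le_sum_of_subset_of_nonneg (Finset.image_subset_iff.2 fun c hc => ?_)
            fun _ _ _ => prodDivLcm_nonneg _
          exact tuple_mem hB (Finset.mem_filter.1 hc).1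
  set H := (∑ b ∈ B, (b : ℝ)⁻¹) ^ Fintype.card (LargeSet k) with hH
  have hT : 0 ≤ (N : ℝ) ^ k * H := by positivity
  have hP' : (4 ^ k : ℝ) / P ≤ (2 ^ (k + 1) : ℝ)⁻¹ := by
    rw [div_le_iff₀ (Nat.cast_pos.2 hP0), inv_mul_eq_div, le_div_iff₀ (by positivity)]
    exact_mod_cast hP
  have hb2 := mul_le_mul_of_nonneg_right hP' hT
  -- The total weight is at least twice the claimed bound, and `P` is large enough that the
  -- discarded part takes at most one copy.
  have heq : ((N : ℝ) / 2) ^ k * H = 2 * ((2 ^ (k + 1) : ℝ)⁻¹ * ((N : ℝ) ^ k * H)) := by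
    rw [div_pow, pow_succ]
    field_simp
  linarith

end Config

/-! ### Expectation as an average over tuples. -/

open MeasureTheory ProbabilityTheory in
/-- The expectation of a function of a uniform sample is its average over all tuples. -/
theorem IsUniformSample.integrable_and_integral_eq {Ω : Type*} [MeasurableSpace Ω] {P : Measure Ω}
    [IsProbabilityMeasure P] {k x : ℕ} (hx : 1 ≤ x) {X : Fin k → Ω → ℕ}
    (h : IsUniformSample P k x X) (f : (Fin k → ℕ) → ℝ) :
    Integrable (fun ω => f (fun i => X i ω)) P ∧
      ∫ ω, f (fun i => X i ω) ∂P =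
        1 / (x : ℝ) ^ k * ∑ n ∈ Fintype.piFinset (fun _ : Fin k => Finset.Icc 1 x), f n := by
  have hX : ∀ i, AEMeasurable (X i) P := fun i => (h.law i).aemeasurable
  have hXX : AEMeasurable (fun ω i => X i ω) P := aemeasurable_pi_lambda _ hX
  set μ : Measure ℕ := uniformOn (Set.Icc 1 x) with hμ
  have hne : (Set.Icc 1 x).Nonempty := ⟨1, by simp [hx]⟩
  have : IsProbabilityMeasure μ := isProbabilityMeasure_uniformOn (Set.finite_Icc 1 x) hne
  have hmap : Measure.map (fun ω i => X i ω) P = Measure.pi fun _ : Fin k => μ := by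
    rw [(iIndepFun_iff_map_fun_eq_pi_map hX).1 h.indep]
    congr 1
    funext i
    exact (h.law i).map_eq
  set ν : Measure (Fin k → ℕ) := Measure.pi fun _ : Fin k => μ with hν
  set s : Finset (Fin k → ℕ) := Fintype.piFinset fun _ : Fin k => Finset.Icc 1 x with hs
  have hμ1 : ∀ j ∈ Finset.Icc 1 x, μ {j} = (x : ENNReal)⁻¹ := by
    intro j hj
    have := @uniformOn_apply_finset ℕ _ _ _ (Finset.Icc 1 x) {j}
    rw [Finset.coe_Icc, Finset.coe_singleton, Finset.inter_singleton_of_mem hj] at this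
    rw [hμ, this]
    simp
  have hν1 : ∀ n ∈ s, ν.real {n} = 1 / (x : ℝ) ^ k := by
    intro n hn
    rw [hs, Fintype.mem_piFinset] at hn
    rw [Measure.real, hν, Measure.pi_singleton, Finset.prod_congr rfl fun i _ => hμ1 _ (hn i)]
    simp
  -- Since `ν` lives on a finite set, every `f` is integrable and its integral is a finite sum.
  have hνs : ∀ᵐ n ∂ν, n ∈ (s : Set (Fin k → ℕ)) := by
    have h1 : ∀ i : Fin k, ∀ᵐ n ∂ν, n i ∈ Set.Icc 1 x := by
      intro i
      refine (Measure.quasiMeasurePreserving_eval (fun _ : Fin k => μ) i).ae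
        (p := fun j => j ∈ Set.Icc 1 x) ?_
      rw [hμ, uniformOn]
      exact ae_cond_mem (Set.finite_Icc 1 x).measurableSet
    filter_upwards [ae_all_iff.2 h1] with n hn
    rw [hs, Finset.mem_coe, Fintype.mem_piFinset]
    exact fun i => Finset.mem_Icc.2 (hn i)
  have hres : ν.restrict (s : Set (Fin k → ℕ)) = ν := Measure.restrict_eq_self_of_ae_mem hνs
  have hint : Integrable f ν := by
    rw [← hres]
    exact IntegrableOn.finset
  have hsm : AEStronglyMeasurable f (Measure.map (fun ω i => X i ω) P) :=
    (measurable_of_countable f).aestronglyMeasurable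
  constructor
  · exact (integrable_map_measure hsm hXX).1 (hmap ▸ hint)
  · rw [← integral_map hXX hsm, hmap]
    conv_lhs => rw [← hres]
    rw [setIntegral_finset s hint.integrableOn, Finset.mul_sum]
    exact Finset.sum_congr rfl fun n hn => by rw [hν1 n hn, smul_eq_mul]

/-! ### Logarithmic estimates and the choice of parameters. -/

/-- The progression `1 + j * Q` alone suffices: its terms are coprime to `Q` and at most `(j + 1) *
Q`. -/
theorem log_sub_log_div_le_sum_inv_coprime {Q z : ℕ} (hQ : 0 < Q) (hz : 1 ≤ z) :
    (Real.log (z + 1 : ℕ) - Real.log Q) / Q ≤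
      ∑ b ∈ Finset.Icc 1 z with b.Coprime Q, (b : ℝ)⁻¹ := by
  have hQ' : (0 : ℝ) < Q := Nat.cast_pos.2 hQ
  -- The number of `j ≥ 0` with `1 + j * Q ≤ z`.
  set t := (z - 1) / Q + 1 with ht
  have htz : z + 1 ≤ (t + 1) * Q := by
    have := Nat.lt_mul_div_succ (z - 1) hQ
    rw [← ht] at this
    rw [add_mul, one_mul, mul_comm]
    omega
  have hlog : Real.log (z + 1 : ℕ) - Real.log Q ≤ harmonic t := by
    refine le_trans ?_ (log_add_one_le_harmonic t)
    rw [sub_le_iff_le_add, ← Real.log_mul (by positivity) hQ'.ne', ← Nat.cast_mul]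
    exact Real.log_le_log (by positivity) (Nat.cast_le.2 htz)
  have hinj : Set.InjOn (fun j => 1 + j * Q) (Finset.range t : Set ℕ) := fun j _ j' _ h =>
    Nat.eq_of_mul_eq_mul_right hQ (Nat.add_left_cancel h)
  calc (Real.log (z + 1 : ℕ) - Real.log Q) / Q ≤ harmonic t / Q := by gcongr
    _ = ∑ j ∈ Finset.range t, ((j + 1 : ℝ))⁻¹ / Q := by
        rw [harmonic, Rat.cast_sum, Finset.sum_div]
        simp
    _ ≤ ∑ j ∈ Finset.range t, ((1 + j * Q : ℕ) : ℝ)⁻¹ := by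
        refine Finset.sum_le_sum fun j _ => ?_
        rw [div_eq_mul_inv, ← mul_inv]
        refine inv_anti₀ (by positivity) ?_
        have : 1 + j * Q ≤ (j + 1) * Q := by nlinarith
        exact_mod_cast this
    _ = ∑ b ∈ (Finset.range t).image (fun j => 1 + j * Q), (b : ℝ)⁻¹ :=
        (Finset.sum_image (f := fun b : ℕ => (b : ℝ)⁻¹) hinj).symm
    _ ≤ _ := by
        refine Finset.sum_le_sum_of_subset_of_nonneg (Finset.image_subset_iff.2 fun j hj => ?_)
          fun _ _ _ => by positivity
        have hj' : j ≤ (z - 1) / Q := Nat.lt_succ_iff.1 (Finset.mem_range.1 hj)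
        have hjz : j * Q ≤ z - 1 := (Nat.le_div_iff_mul_le hQ).1 hj'
        rw [Finset.mem_filter, Finset.mem_Icc]
        exact ⟨⟨by omega, by omega⟩, by simp⟩

theorem exists_pow_le_lt_succ_pow {K N : ℕ} (hK : K ≠ 0) (hN : 1 ≤ N) :
    ∃ z, 1 ≤ z ∧ z ^ K ≤ N ∧ N < (z + 1) ^ K := by
  have hex : ∃ z, N < (z + 1) ^ K :=
    ⟨N, (Nat.lt_succ_self N).trans_le (Nat.le_self_pow hK _)⟩
  classical
  have hspec := Nat.find_spec hex
  have hpos : Nat.find hex ≠ 0 := by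
    intro h
    rw [h, zero_add, one_pow] at hspec
    omega
  obtain ⟨y, hy⟩ := Nat.exists_eq_succ_of_ne_zero hpos
  have hmin := Nat.find_min hex (m := y) (by omega)
  rw [not_lt] at hmin
  exact ⟨Nat.find hex, Nat.pos_of_ne_zero hpos, by rw [hy]; exact hmin, hspec⟩

theorem one_le_prodDivLcm {k : ℕ} {n : Fin k → ℕ} (hn : ∀ i, 0 < n i) : 1 ≤ prodDivLcm n := by
  have hdvd : Finset.univ.lcm n ∣ ∏ i, n i :=
    Finset.lcm_dvd fun i hi => Finset.dvd_prod_of_mem n hi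
  have hpos : 0 < ∏ i, n i := Finset.prod_pos fun i _ => hn i
  rw [prodDivLcm, one_le_div (Nat.cast_pos.2 (Nat.pos_of_dvd_of_pos hdvd hpos)),
    ← Nat.cast_prod]
  exact Nat.cast_le.2 (Nat.le_of_dvd hpos hdvd)

theorem pow_le_sum_prodDivLcm (k N : ℕ) :
    (N : ℝ) ^ k ≤ ∑ n ∈ Fintype.piFinset (fun _ : Fin k => Finset.Icc 1 N), prodDivLcm n := by
  calc (N : ℝ) ^ k = ∑ _n ∈ Fintype.piFinset (fun _ : Fin k => Finset.Icc 1 N), (1 : ℝ) := by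
        simp
    _ ≤ _ := Finset.sum_le_sum fun n hn => one_le_prodDivLcm fun i =>
        (Finset.mem_Icc.1 (Fintype.mem_piFinset.1 hn i)).1

theorem exists_le_sum_prodDivLcm (k : ℕ) : ∃ c : ℝ, 0 < c ∧ ∀ N : ℕ, 2 ≤ N →
    c * ((N : ℝ) ^ k * Real.log N ^ (2 ^ k - k - 1)) ≤
      ∑ n ∈ Fintype.piFinset (fun _ : Fin k => Finset.Icc 1 N), prodDivLcm n := by
  rw [← card_largeSet]
  set M := Fintype.card (LargeSet k)
  set P := 4 ^ k * 2 ^ (k + 1) with hP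
  set Q := P.factorial
  have hQ : 0 < Q := P.factorial_pos
  have hQ1 : (1 : ℝ) ≤ Q := by exact_mod_cast hQ
  have hQ' : (0 : ℝ) < Q := by linarith
  -- Once `log N ≥ L`, subtracting `log Q` costs at most half of `log N / 2 ^ k`, the lower bound
  -- for `log (z + 1)`. For smaller `N` the logarithm is bounded and the trivial estimate `N ^ k` is
  -- enough.
  set L : ℝ := 2 * 2 ^ k * Real.log Q
  have hL : 0 ≤ L := mul_nonneg (by positivity) (Real.log_nonneg hQ1)
  set c₁ : ℝ := (2 ^ (k + 1) : ℝ)⁻¹ * ((2 * 2 ^ k * Q : ℝ)⁻¹) ^ M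
  set c₂ : ℝ := ((L + 1) ^ M)⁻¹
  have hc₁ : 0 < c₁ := by positivity
  have hc₂ : 0 < c₂ := by positivity
  refine ⟨min c₁ c₂, lt_min hc₁ hc₂, fun N hN => ?_⟩
  have hlog : 0 ≤ Real.log N := Real.log_natCast_nonneg N
  rcases le_total L (Real.log N) with h | h
  · obtain ⟨z, hz1, hzN, hNz⟩ := exists_pow_le_lt_succ_pow (K := 2 ^ k) (by positivity)
      (one_le_two.trans hN)
    set B := (Finset.Icc 1 z).filter (·.Coprime Q)
    have hB : ∀ b ∈ B, 0 < b := fun b hb =>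
      (Finset.mem_Icc.1 (Finset.mem_filter.1 hb).1).1
    have hmain := Config.le_sum_prodDivLcm (k := k) (B := B) hB
      (fun b hb e he => by
        rw [Finset.mem_filter, Finset.mem_Icc] at hb ⊢
        exact ⟨⟨Nat.pos_of_dvd_of_pos he hb.1.1, (Nat.le_of_dvd hb.1.1 he).trans hb.1.2⟩,
          hb.2.coprime_dvd_left he⟩)
      (fun b hb => (Finset.mem_Icc.1 (Finset.mem_filter.1 hb).1).2) hz1 hzN hP.le
      (fun b hb p hp hpb => by
        by_contra hpP
        have hpQ : p ∣ Q := (hp.dvd_factorial).2 (not_lt.1 hpP)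
        exact hp.one_lt.ne'
          (Nat.dvd_one.1 ((Finset.mem_filter.1 hb).2 ▸ Nat.dvd_gcd hpb hpQ)))
    refine le_trans ?_ hmain
    have hlogz : Real.log N ≤ 2 ^ k * Real.log (z + 1 : ℕ) := by
      have : Real.log N ≤ Real.log (((z + 1) ^ 2 ^ k : ℕ) : ℝ) :=
        Real.log_le_log (by positivity) (Nat.cast_le.2 hNz.le)
      rwa [Nat.cast_pow, Real.log_pow, Nat.cast_pow, Nat.cast_ofNat] at this
    have hH : (2 * 2 ^ k * Q : ℝ)⁻¹ * Real.log N ≤ ∑ b ∈ B, (b : ℝ)⁻¹ := by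
      refine le_trans ?_ (log_sub_log_div_le_sum_inv_coprime hQ hz1)
      rw [inv_mul_eq_div, div_le_div_iff₀ (by positivity) hQ']
      have : Real.log N ≤ (Real.log (z + 1 : ℕ) - Real.log Q) * (2 * 2 ^ k) := by
        simp only [L] at h
        linarith
      calc Real.log N * Q ≤ (Real.log (z + 1 : ℕ) - Real.log Q) * (2 * 2 ^ k) * Q := by gcongr
        _ = _ := by ring
    calc min c₁ c₂ * ((N : ℝ) ^ k * Real.log N ^ M)
        ≤ c₁ * ((N : ℝ) ^ k * Real.log N ^ M) := by gcongr; exact min_le_left _ _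
      _ = (2 ^ (k + 1) : ℝ)⁻¹ * ((N : ℝ) ^ k * ((2 * 2 ^ k * Q : ℝ)⁻¹ * Real.log N) ^ M) := by
          rw [mul_pow]; ring
      _ ≤ _ := by gcongr
  · refine le_trans ?_ (pow_le_sum_prodDivLcm k N)
    calc min c₁ c₂ * ((N : ℝ) ^ k * Real.log N ^ M)
        ≤ c₂ * ((N : ℝ) ^ k * (L + 1) ^ M) := by
          gcongr
          · exact min_le_right _ _
          · linarith
      _ = (N : ℝ) ^ k := by
          have : (L + 1) ^ M ≠ 0 := by positivity
          simp only [c₂]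
          field_simp

theorem sum_prodDivLcm_le_mul_log_pow (k : ℕ) {N : ℕ} (hN : 2 ≤ N) :
    ∑ n ∈ Fintype.piFinset (fun _ : Fin k => Finset.Icc 1 N), prodDivLcm n ≤
      3 ^ (2 ^ k - k - 1) * ((N : ℝ) ^ k * Real.log N ^ (2 ^ k - k - 1)) := by
  have hN' : (2 : ℝ) ≤ N := by exact_mod_cast hN
  have hlog : Real.log 2 ≤ Real.log N := Real.log_le_log two_pos hN'
  have h2 := Real.log_two_gt_d9
  -- The sum is at most `1 + log N`, and `1 ≤ 2 * log N` because `log 2 > 1 / 2`.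
  have hH : ∑ b ∈ Finset.Icc 1 N, (b : ℝ)⁻¹ ≤ 3 * Real.log N := by
    have := harmonic_le_one_add_log N
    rw [harmonic_eq_sum_Icc, Rat.cast_sum] at this
    simp only [Rat.cast_inv, Rat.cast_natCast] at this
    linarith
  refine (Config.sum_prodDivLcm_le k N).trans ?_
  rw [card_largeSet, mul_left_comm, ← mul_pow]
  gcongr

/-! ### Passage to real `x` and conclusion. -/

theorem exists_lcmV_bounds (k : ℕ) : ∃ c C : ℝ, 0 < c ∧ 0 < C ∧
    ∀ x : ℝ, 2 ≤ x → c * (x ^ k * Real.log x ^ (2 ^ k - k - 1)) ≤ lcmV k x ∧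
      lcmV k x ≤ C * (x ^ k * Real.log x ^ (2 ^ k - k - 1)) := by
  obtain ⟨c, hc, hlow⟩ := exists_le_sum_prodDivLcm k
  set M := 2 ^ k - k - 1
  have hreal : ∀ x : ℝ, 2 ≤ x → c * (2⁻¹ ^ k * 2⁻¹ ^ M) * (x ^ k * Real.log x ^ M) ≤ lcmV k x ∧
      lcmV k x ≤ 3 ^ M * (x ^ k * Real.log x ^ M) := by
    intro x hx
    have hN : 2 ≤ ⌊x⌋₊ := Nat.le_floor (by exact_mod_cast hx)
    have hN' : (2 : ℝ) ≤ ⌊x⌋₊ := by exact_mod_cast hN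
    have hNx : (⌊x⌋₊ : ℝ) ≤ x := Nat.floor_le (by linarith)
    have hxN : x < ⌊x⌋₊ + 1 := Nat.lt_floor_add_one x
    have hx0 : 0 < x := by linarith
    have hlogN : 0 ≤ Real.log ⌊x⌋₊ := Real.log_natCast_nonneg _
    have hlogx : 0 ≤ Real.log x := Real.log_nonneg (by linarith)
    constructor
    · refine le_trans ?_ (hlow _ hN)
      have h1 : 2⁻¹ * x ≤ ⌊x⌋₊ := by linarith
      -- For `x ≥ 2`, `x < ⌊x⌋₊ + 1 ≤ ⌊x⌋₊ ^ 2`.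
      have h2 : 2⁻¹ * Real.log x ≤ Real.log ⌊x⌋₊ := by
        have : Real.log x ≤ Real.log ((⌊x⌋₊ : ℝ) ^ 2) := Real.log_le_log hx0 (by nlinarith)
        rw [Real.log_pow, Nat.cast_ofNat] at this
        linarith
      calc c * (2⁻¹ ^ k * 2⁻¹ ^ M) * (x ^ k * Real.log x ^ M)
          = c * ((2⁻¹ * x) ^ k * (2⁻¹ * Real.log x) ^ M) := by
            rw [mul_pow, mul_pow]; ring
        _ ≤ _ := by gcongr
    · refine (sum_prodDivLcm_le_mul_log_pow k hN).trans ?_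
      gcongr
  exact ⟨c * (2⁻¹ ^ k * 2⁻¹ ^ M), 3 ^ M, by positivity, by positivity, hreal⟩

theorem theorem1p3 (k : ℕ) (hk : 2 ≤ k) :
    ∃ c C : ℝ, 0 < c ∧ 0 < C ∧
      (∀ (x : ℕ), 2 ≤ x →
        ∀ (Ω : Type*) [MeasurableSpace Ω] (P : MeasureTheory.Measure Ω)
          [MeasureTheory.IsProbabilityMeasure P] (X : Fin k → Ω → ℕ),
          IsUniformSample P k x X →
            MeasureTheory.Integrable (fun ω => prodDivLcm (fun i => X i ω)) P ∧
            c * Real.log x ^ (2 ^ k - k - 1) ≤ ∫ ω, prodDivLcm (fun i => X i ω) ∂P ∧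
            ∫ ω, prodDivLcm (fun i => X i ω) ∂P ≤ C * Real.log x ^ (2 ^ k - k - 1)) ∧
      (∀ (x : ℝ), 2 ≤ x →
        c * Real.log x ^ (2 ^ k - k - 1) ≤ 1 / x ^ k * lcmV k x ∧
        1 / x ^ k * lcmV k x ≤ C * Real.log x ^ (2 ^ k - k - 1)) ∧
      (∀ (x : ℝ), 2 ≤ x →
        c * (x ^ k * Real.log x ^ (2 ^ k - k - 1)) ≤ lcmV k x ∧
        lcmV k x ≤ C * (x ^ k * Real.log x ^ (2 ^ k - k - 1))) := by
  obtain ⟨c, C, hc, hC, h⟩ := exists_lcmV_bounds k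
  have hdiv : ∀ x : ℝ, 2 ≤ x →
      c * Real.log x ^ (2 ^ k - k - 1) ≤ 1 / x ^ k * lcmV k x ∧
        1 / x ^ k * lcmV k x ≤ C * Real.log x ^ (2 ^ k - k - 1) := by
    intro x hx
    have hx0 : 0 < x ^ k := pow_pos (by linarith) k
    rw [one_div_mul_eq_div, le_div_iff₀ hx0, div_le_iff₀ hx0, mul_right_comm, mul_assoc,
      mul_right_comm C, mul_assoc C]
    have := h x hx
    rw [mul_comm (x ^ k)] at this
    exact ⟨by linarith [this.1], by linarith [this.2]⟩
  refine ⟨c, C, hc, hC, fun x hx Ω _ P _ X hX => ?_, hdiv, h⟩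
  obtain ⟨hint, heq⟩ := hX.integrable_and_integral_eq (one_le_two.trans hx) prodDivLcm
  have hV : ∑ n ∈ Fintype.piFinset (fun _ : Fin k => Finset.Icc 1 x), prodDivLcm n =
      lcmV k x := by
    rw [lcmV, Nat.floor_natCast]
  rw [hV] at heq
  rw [heq]
  exact ⟨hint, hdiv x (by exact_mod_cast hx)⟩
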